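/- **Model.** A word RAM with $w$-bit words ($n<2^w$, $\sigma\le 2^w$) runs a fixed program, with a constant number of registers and of word-indexed arrays, once per letter; arithmetic, bitwise, load, store and test instructions take one step each. The text $T[1..n]$ over an alphabet of size $\sigma$ is read online from left to right, and $n$ is not known in advance. **Definitions.** $\mathsf{LRS}[i]$ is the length of the longest suffix of $T[1..i]$ that occurs at least twice in $T[1..i]$. $\mathsf{LPF}[j]$ is the length of the longest prefix of $T[j..n]$ that has another occurrence starting at a position $j'<j$ (and $0$ if $j=1$). An algorithm *solves SuffixUpdate* in time $t_{\mathrm{SU}}$ if in each round, on reading $T[i]$, it turns the suffix tree of the inverted text $T[i-1]\cdots T[1]$ into that of $T[i]\cdots T[1]$ in at most $t_{\mathrm{SU}}$ steps in the worst case. Here the tree (in which every suffix ends at an explicit node) is held in memory with, for each node, its parent and a text interval carrying the label of the edge from the parent, and with the root and the leaf of the whole string accessible. **Theorem.** There is an absolute constant $C$ such that for every online suffix tree algorithm $P$ there is an online algorithm $Q$ with the following property. For all $w,n,\sigma$ as above: if $P$ solves SuffixUpdate for all texts of length $n$ over $\sigma$ letters in worst-case time $t_{\mathrm{SU}}$ per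 letter, using at most $s(i)$ array cells for the first $i$ letters, then for every such text $T$, $Q$ computes the array $\mathsf{LPF}$ of $T$ online in at most $C\,t_{\mathrm{SU}}$ steps per letter, with at most $\max_i\mathsf{LRS}[i]$ delayed ending values at each round. Precisely: 1. After round $i$, $0\le i\le n$, the values $\mathsf{LPF}[1],\dots,\mathsf{LPF}[d_i]$ of $T[1..n]$ have been written to the output array, where $d_i\le i$ is held in a register, $d_{i}\le d_{i+1}$ for $i<n$, and $$i-d_i\le\max_{1\le k\le i}\mathsf{LRS}[k]$$ (the maximum over the empty set being $0$). 2. If the text ends after $i$ letters, a final procedure of at most $C(i-d_i+1)$ steps completes the output to the whole $\mathsf{LPF}$ array of $T[1..i]$. 3. For the first $i$ letters (the final procedure included) $Q$ uses at most $C(s(i)+i+1)$ array cells. -/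

import Mathlib

/-! ### Strings: longest repeating suffixes, longest previous factors, suffix trees -/

/-- The (0-based) starting positions of the occurrences of `u` in `S`. -/
def occ {α : Type*} (S u : List α) : Set ℕ :=
  {p | p + u.length ≤ S.length ∧ (S.drop p).take u.length = u}

/-- `LRS[i]` for `1 ≤ i ≤ |T|`: the length of the longest suffix of the prefix `T[1..i]` that
occurs at least twice in `T[1..i]`. -/
noncomputable def LRS {α : Type*} (T : List α) (i : ℕ) : ℕ :=
  sSup {l | ∃ u : List α, u.length = l ∧ u <:+ T.take i ∧ 2 ≤ (occ (T.take i) u).ncard}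

/-- `max {LRS[1], …, LRS[i]}` (and `0` for `i = 0`). -/
noncomputable def maxLRS {α : Type*} (T : List α) (i : ℕ) : ℕ :=
  (Finset.Icc 1 i).sup (LRS T)

/-- The longest previous factor array with positions counted from `0`: `LPF T j` is the length of
the longest prefix of the suffix of `T` starting at `j` that has another occurrence starting at some
`j' < j` (and `0` at the first position). -/
noncomputable def LPF {α : Type*} (T : List α) (j : ℕ) : ℕ :=
  sSup {l | ∃ u : List α, u.length = l ∧ u <+: T.drop j ∧ ∃ j' < j, u <+: T.drop j'}

/-- The explicit nodes of the suffix tree of `S` (the compacted trie of all suffixes of `S`), each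
named by the string spelled out on its path from the root: the suffixes of `S`, among them the root
`[]`, and the substrings of `S` that can be continued by two different letters. -/
def IsSTNode {α : Type*} (S u : List α) : Prop :=
  u <:+ S ∨ ∃ a b : α, a ≠ b ∧ (u ++ [a]) <:+: S ∧ (u ++ [b]) <:+: S

/-- `p` is the parent of the node `u` in the suffix tree of `S`: the lowest explicit node strictly
above `u`. The edge from `p` to `u` is labelled by `u.drop p.length`. -/
def IsSTParent {α : Type*} (S p u : List α) : Prop :=
  IsSTNode S u ∧ IsSTNode S p ∧ p <+: u ∧ p ≠ u ∧
    ∀ q : List α, IsSTNode S q → q <+: u → q ≠ u → q <+: p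

/-! ### The word RAM -/

/-- Memory of a word RAM with `w`-bit words: registers, arrays of words indexed by words, and (as
bookkeeping for space bounds) the set of array cells accessed so far. A program is finite, so it
uses only a constant number of registers and of arrays. -/
structure State (w : ℕ) where
  reg : ℕ → BitVec w
  arr : ℕ → BitVec w → BitVec w
  used : Finset (ℕ × BitVec w)

/-- Arithmetic and bitwise operations on words. -/
inductive Op where
  | add | sub | mul | div | mod | and | or | xor | shl | shr

def Op.eval {w : ℕ} : Op → BitVec w → BitVec w → BitVec w
  | .add, x, y => x + y
  | .sub, x, y => x - y
  | .mul, x, y => x * y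
  | .div, x, y => x / y
  | .mod, x, y => x % y
  | .and, x, y => x &&& y
  | .or, x, y => x ||| y
  | .xor, x, y => x ^^^ y
  | .shl, x, y => x <<< y
  | .shr, x, y => x >>> y

/-- Tests on two registers: equality, and comparison as unsigned numbers. -/
inductive Test where
  | eq (a b : ℕ)
  | lt (a b : ℕ)

def Test.holds {w : ℕ} (s : State w) : Test → Prop
  | .eq a b => s.reg a = s.reg b
  | .lt a b => (s.reg a).toNat < (s.reg b).toNat

/-- Word RAM programs. The arguments are numbers of registers (`d a b`), numbers of arrays (`A`) and
constants (`v`); a program does not depend on the word size. -/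
inductive Cmd where
  | skip
  | const (d v : ℕ)
  | copy (d a : ℕ)
  | op (o : Op) (d a b : ℕ)
  | load (d A a : ℕ)
  | store (A a b : ℕ)
  | seq (p q : Cmd)
  | ite (b : Test) (p q : Cmd)
  | loop (b : Test) (p : Cmd)

def State.setReg {w : ℕ} (s : State w) (d : ℕ) (x : BitVec w) : State w :=
  { s with reg := Function.update s.reg d x }

def State.load {w : ℕ} (s : State w) (d A a : ℕ) : State w :=
  { s with
    reg := Function.update s.reg d (s.arr A (s.reg a))
    used := insert (A, s.reg a) s.used }

def State.store {w : ℕ} (s : State w) (A a b : ℕ) : State w :=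
  { s with
    arr := Function.update s.arr A (Function.update (s.arr A) (s.reg a) (s.reg b))
    used := insert (A, s.reg a) s.used }

/-- `Exec p s s' c`: the program `p`, started in memory `s`, halts in memory `s'` after exactly `c`
steps; every instruction and every evaluation of a test is one step. -/
inductive Exec {w : ℕ} : Cmd → State w → State w → ℕ → Prop where
  | skip (s : State w) : Exec .skip s s 1
  | const (s : State w) (d v : ℕ) : Exec (.const d v) s (s.setReg d (BitVec.ofNat w v)) 1
  | copy (s : State w) (d a : ℕ) : Exec (.copy d a) s (s.setReg d (s.reg a)) 1
  | op (s : State w) (o : Op) (d a b : ℕ) :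
      Exec (.op o d a b) s (s.setReg d (o.eval (s.reg a) (s.reg b))) 1
  | load (s : State w) (d A a : ℕ) : Exec (.load d A a) s (s.load d A a) 1
  | store (s : State w) (A a b : ℕ) : Exec (.store A a b) s (s.store A a b) 1
  | seq {p q : Cmd} {s₁ s₂ s₃ : State w} {c₁ c₂ : ℕ} :
      Exec p s₁ s₂ c₁ → Exec q s₂ s₃ c₂ → Exec (.seq p q) s₁ s₃ (c₁ + c₂)
  | ite_true {b : Test} {p q : Cmd} {s s' : State w} {c : ℕ} :
      b.holds s → Exec p s s' c → Exec (.ite b p q) s s' (c + 1)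
  | ite_false {b : Test} {p q : Cmd} {s s' : State w} {c : ℕ} :
      ¬ b.holds s → Exec q s s' c → Exec (.ite b p q) s s' (c + 1)
  | loop_done {b : Test} {p : Cmd} {s : State w} :
      ¬ b.holds s → Exec (.loop b p) s s 1
  | loop_step {b : Test} {p : Cmd} {s₁ s₂ s₃ : State w} {c₁ c₂ : ℕ} :
      b.holds s₁ → Exec p s₁ s₂ c₁ → Exec (.loop b p) s₂ s₃ c₂ →
      Exec (.loop b p) s₁ s₃ (c₁ + c₂ + 1)

/-- The memory before the first letter: all zero, except that register `1` holds the word size and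
register `2` the alphabet size. The length of the text is not given. -/
def State.start (w σ : ℕ) : State w where
  reg := fun r => if r = 1 then BitVec.ofNat w w else if r = 2 then BitVec.ofNat w σ else 0
  arr := fun _ _ => 0
  used := ∅

/-- `st 0, st 1, …, st |T|` are the memories of the online run on the text `T` over the alphabet
`{0, …, σ - 1}` of the algorithm that executes `p` once per letter, the next letter being put into
register `0`, and every round takes at most `t` steps. -/
def OnlineRun {w σ : ℕ} (p : Cmd) (T : List (Fin σ)) (t : ℕ) (st : ℕ → State w) : Prop :=
  st 0 = State.start w σ ∧
    ∀ (i : ℕ) (hi : i < T.length), ∃ c ≤ t,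
      Exec p ((st i).setReg 0 (BitVec.ofNat w (T[i]).val)) (st (i + 1)) c

/-! ### The problem SuffixUpdate -/

/-- An online suffix tree algorithm: the program executed for each letter, and the places where it
keeps the tree: registers with the root and with the leaf of the whole indexed string, and arrays,
indexed by nodes, with the parent and with the start and the length of a text interval that carries
the label of the edge from the parent. -/
structure SuffixTreeAlg where
  prog : Cmd
  rootReg : ℕ
  leafReg : ℕ
  parentArr : ℕ
  startArr : ℕ
  lenArr : ℕ

/-- The memory `s` holds the suffix tree of `X.reverse`, where `X` is the text read so far: `ν` assigns
different words to different nodes, and an edge label is stored as an interval of `X` that is read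
from right to left. -/
def HoldsSuffixTree {w σ : ℕ} (P : SuffixTreeAlg) (s : State w) (X : List (Fin σ)) : Prop :=
  ∃ ν : List (Fin σ) → BitVec w,
    Set.InjOn ν {u | IsSTNode X.reverse u} ∧
    s.reg P.rootReg = ν [] ∧
    s.reg P.leafReg = ν X.reverse ∧
    ∀ u p : List (Fin σ), IsSTParent X.reverse p u →
      s.arr P.parentArr (ν u) = ν p ∧
      (s.arr P.lenArr (ν u)).toNat = u.length - p.length ∧
      ((X.drop (s.arr P.startArr (ν u)).toNat).take (u.length - p.length)).reverse
        = u.drop p.length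

/-- With `w`-bit words, for all texts of length `n` over `σ` letters, read online from left to right,
`P` maintains the suffix tree of the inverted text (so that each letter is one SuffixUpdate) in at
most `t` steps per letter, using at most `space i` array cells for the first `i` letters. -/
def SolvesSuffixUpdate (P : SuffixTreeAlg) (w n σ t : ℕ) (space : ℕ → ℕ) : Prop :=
  ∀ T : List (Fin σ), T.length = n →
    ∃ st : ℕ → State w, OnlineRun P.prog T t st ∧
      ∀ i, 1 ≤ i → i ≤ n →
        HoldsSuffixTree P (st i) (T.take i) ∧ (st i).used.card ≤ space i

/-! ### Online computation of the LPF array -/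

/-- An online LPF algorithm: the program executed for each letter, the program that completes the
array when the text ends, the output array, and the register with the number of values computed. -/
structure LPFAlg where
  prog : Cmd
  finish : Cmd
  lpfArr : ℕ
  doneReg : ℕ

/-- The number of values that `Q` has computed in memory `s`. -/
def LPFAlg.done {w : ℕ} (Q : LPFAlg) (s : State w) : ℕ := (s.reg Q.doneReg).toNat

/-- With `w`-bit words, for all texts `T` of length `n` over `σ` letters, `Q` computes the LPF array
of `T` online in at most `t` steps per letter: after `i` letters the first `d_i` entries of the output
array are final values of the array of `T`, where `d_i` never decreases, and at most
`max {LRS[1], …, LRS[i]}` of the first `i` values are delayed. If the text ends after `i` letters,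
the delayed values are completed in at most `f` steps for each of them (plus `f`).
At most `space i` array cells are used for the first `i` letters. -/
def ComputesLPFOnline (Q : LPFAlg) (w n σ t f : ℕ) (space : ℕ → ℕ) : Prop :=
  ∀ T : List (Fin σ), T.length = n →
    ∃ st : ℕ → State w, OnlineRun Q.prog T t st ∧
      (∀ i < n, Q.done (st i) ≤ Q.done (st (i + 1))) ∧
      ∀ i ≤ n,
        Q.done (st i) ≤ i ∧
        i - Q.done (st i) ≤ maxLRS T i ∧
        (∀ j < Q.done (st i), ((st i).arr Q.lpfArr (BitVec.ofNat w j)).toNat = LPF T j) ∧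
        (st i).used.card ≤ space i ∧
        ∃ (s' : State w) (c : ℕ), Exec Q.finish (st i) s' c ∧
          c ≤ f * (i - Q.done (st i) + 1) ∧
          (∀ j < i, (s'.arr Q.lpfArr (BitVec.ofNat w j)).toNat = LPF (T.take i) j) ∧
          s'.used.card ≤ space i

/-! Call position `j` open after `i` letters if the factor from `j` to the last letter read has an
earlier occurrence. Suffixes of repeated factors are repeated, so the open positions below `i` are
exactly those from `i - LRS[i]`, i.e. `finalBound T i`, onwards (`repeats_iff_LRS`). Prefixes of
repeated factors are repeated as well, so if `k` is the first letter with `finalBound T k > j`, then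
the longest repeated factor at `j` stops just before letter `k`, and the LPF value at `j` is `k - 1
- j` whatever follows (`LPF_take_eq`). A position still open when the text ends after `i` letters
has value `i - j`.

The suffix tree supplies `finalBound` in constant time. Explicit proper prefixes of the inverted
text are repeated suffixes of the text, and each repeated suffix lies above such a node, so the
parent of the longest leaf has depth `LRS[i]` and the edge into that leaf has length `i - LRS[i]`.

The algorithm runs two pointers `d ≤ k ≤ i`: the next position to be written and the letter tried
for it. A constant-time step increases one of them unless `k = i` and `d ≥ finalBound T i`. Two
steps per round keep `2 * i ≤ d + k + max LRS`: either `d + k` grows by 2, or the pointers are stuck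
and the bound holds outright. With `k ≤ i` this bounds the delay `i - d`; with `d ≤ k` at most `2 *
(i - d)` steps remain at the end of the text. The program of `P` runs unchanged beside the new
registers and arrays (`Exec.simulate`). -/

/-! ### Repetitions inside a string -/

/-- The factor of `T` at the positions `j, …, e - 1` also occurs at an earlier position. -/
def Repeats {α : Type*} (T : List α) (j e : ℕ) : Prop :=
  ∃ d, 0 < d ∧ d ≤ j ∧ ∀ x, j ≤ x → x < e → T[x]? = T[x - d]?

namespace Repeats

variable {α : Type*} {T : List α} {j e : ℕ}

theorem anti_right (h : Repeats T j e) {e' : ℕ} (he : e' ≤ e) : Repeats T j e' := by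
  obtain ⟨d, h0, h1, h2⟩ := h
  exact ⟨d, h0, h1, fun x hx hx' => h2 x hx (by omega)⟩

theorem mono_left (h : Repeats T j e) {j' : ℕ} (hj : j ≤ j') : Repeats T j' e := by
  obtain ⟨d, h0, h1, h2⟩ := h
  exact ⟨d, h0, by omega, fun x hx hx' => h2 x (by omega) hx'⟩

theorem of_le (h : e ≤ j) (hj : 0 < j) : Repeats T j e :=
  ⟨j, hj, le_rfl, fun x hx hx' => by omega⟩

theorem pos (h : Repeats T j e) : 0 < j := by
  obtain ⟨d, h0, h1, -⟩ := h
  omega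

theorem take_iff {i : ℕ} (he : e ≤ i) : Repeats (T.take i) j e ↔ Repeats T j e := by
  unfold Repeats
  refine exists_congr fun d => and_congr_right fun _ => and_congr_right fun _ =>
    forall_congr' fun x => forall_congr' fun _ => forall_congr' fun hx => ?_
  rw [List.getElem?_take_of_lt (by omega), List.getElem?_take_of_lt (by omega)]

end Repeats

theorem prefix_drop_iff {α : Type*} {T u : List α} {j : ℕ} :
    u <+: T.drop j ↔ ∀ x < u.length, T[j + x]? = u[x]? := by
  rw [List.prefix_iff_getElem?]
  refine forall_congr' fun x => forall_congr' fun hx => ?_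
  rw [List.getElem?_drop, List.getElem?_eq_getElem hx]

/-- An occurrence at `j' < j` is the shift `d = j - j'`; overlaps are allowed. -/
theorem exists_previous_occurrence_iff {α : Type*} {T : List α} {j l : ℕ} (hj : j ≤ T.length) :
    (∃ u : List α, u.length = l ∧ u <+: T.drop j ∧ ∃ j' < j, u <+: T.drop j') ↔
      j + l ≤ T.length ∧ Repeats T j (j + l) := by
  constructor
  · rintro ⟨u, rfl, h1, j', hj', h2⟩
    have hl := h1.length_le
    rw [List.length_drop] at hl
    rw [prefix_drop_iff] at h1 h2
    refine ⟨by omega, j - j', by omega, by omega, fun x hx hx' => ?_⟩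
    have e1 := h1 (x - j) (by omega)
    have e2 := h2 (x - j) (by omega)
    rw [show j + (x - j) = x by omega] at e1
    rw [show j' + (x - j) = x - (j - j') by omega] at e2
    rw [e1, e2]
  · rintro ⟨hl, d, h0, h1, h2⟩
    have hlen : ((T.drop j).take l).length = l := by simp; omega
    refine ⟨(T.drop j).take l, hlen, List.take_prefix _ _, j - d, by omega, ?_⟩
    rw [prefix_drop_iff, hlen]
    intro x hx
    rw [List.getElem?_take_of_lt hx, List.getElem?_drop, h2 (j + x) (by omega) (by omega)]
    congr 1
    omega

theorem LPF_eq_of_repeats {α : Type*} {T : List α} {j e : ℕ} (hje : j ≤ e) (he : e ≤ T.length)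
    (h : Repeats T j e) (hn : e < T.length → ¬ Repeats T j (e + 1)) : LPF T j = e - j := by
  unfold LPF
  simp only [exists_previous_occurrence_iff (hje.trans he)]
  apply IsGreatest.csSup_eq
  refine ⟨⟨by omega, by rwa [show j + (e - j) = e by omega]⟩, ?_⟩
  rintro l ⟨h1, h2⟩
  by_contra hlt
  exact hn (by omega) (h2.anti_right (by omega))

theorem LPF_zero {α : Type*} (T : List α) : LPF T 0 = 0 := by
  simp [LPF]

theorem occurs_twice_iff {α : Type*} {X : List α} {l : ℕ} :
    (∃ u : List α, u.length = l ∧ u <:+ X ∧ 2 ≤ (occ X u).ncard) ↔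
      l ≤ X.length ∧ Repeats X (X.length - l) X.length := by
  have mem (u : List α) (p : ℕ) : p ∈ occ X u ↔
      p + u.length ≤ X.length ∧ ∀ x < u.length, X[p + x]? = u[x]? := by
    rw [← prefix_drop_iff, List.prefix_iff_eq_take, eq_comm (a := u)]
    rfl
  constructor
  · rintro ⟨u, rfl, h1, h2⟩
    have hl := h1.length_le
    -- The suffix starts at the last position where `u` fits, so any other occurrence is earlier.
    obtain ⟨p, hp, hne⟩ := (occ X u).exists_ne_of_one_lt_ncard h2 (X.length - u.length)
    rw [mem] at hp
    refine ⟨hl, X.length - u.length - p, by omega, by omega, fun x hx hx' => ?_⟩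
    have e1 := hp.2 (x - (X.length - u.length)) (by omega)
    rw [show p + (x - (X.length - u.length)) = x - (X.length - u.length - p) by omega] at e1
    have h1 := List.suffix_iff_eq_drop.1 h1
    have e2 : u[x - (X.length - u.length)]? = X[x]? := by
      conv_lhs => rw [h1]
      rw [List.length_drop, List.getElem?_drop]
      congr 1
      omega
    rw [e1, e2]
  · rintro ⟨hl, d, h0, h1, h2⟩
    have hlen : (X.drop (X.length - l)).length = l := by simp; omega
    refine ⟨X.drop (X.length - l), hlen, List.drop_suffix _ _, ?_⟩
    -- `ncard` is 0 on infinite sets, so counting two occurrences needs finiteness.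
    have hfin : (occ X (X.drop (X.length - l))).Finite :=
      (Set.finite_Iic X.length).subset fun p hp => by
        have := ((mem _ _).1 hp).1
        simp only [Set.mem_Iic]
        omega
    have m1 : X.length - l ∈ occ X (X.drop (X.length - l)) := by
      rw [mem, hlen]
      exact ⟨by omega, fun x hx => by rw [List.getElem?_drop]⟩
    have m2 : X.length - l - d ∈ occ X (X.drop (X.length - l)) := by
      rw [mem, hlen]
      refine ⟨by omega, fun x hx => ?_⟩
      rw [List.getElem?_drop, h2 (X.length - l + x) (by omega) (by omega)]
      congr 1
      omega
    exact (Set.one_lt_ncard hfin).2 ⟨_, m1, _, m2, by omega⟩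

theorem isGreatest_LRS {α : Type*} {T : List α} {i : ℕ} (hi : 0 < i) (hT : i ≤ T.length) :
    IsGreatest {l | l ≤ i ∧ Repeats T (i - l) i} (LRS T i) := by
  have hlen : (T.take i).length = i := by simp; omega
  have hset : {l | ∃ u : List α, u.length = l ∧ u <:+ T.take i ∧ 2 ≤ (occ (T.take i) u).ncard} =
      {l | l ≤ i ∧ Repeats T (i - l) i} := by
    ext l
    rw [Set.mem_ofPred_eq, occurs_twice_iff, hlen, Repeats.take_iff le_rfl]
    rfl
  unfold LRS
  rw [hset]
  have hb : BddAbove {l | l ≤ i ∧ Repeats T (i - l) i} := ⟨i, fun l hl => hl.1⟩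
  exact ⟨Nat.sSup_mem ⟨0, by omega, Repeats.of_le (by omega) (by omega)⟩ hb,
    fun l hl => le_csSup hb hl⟩

/-- A factor ending with the `i`-th letter is repeated iff it is not longer than `LRS T i`. -/
theorem repeats_iff_LRS {α : Type*} {T : List α} {i j : ℕ} (hi : 0 < i) (hT : i ≤ T.length)
    (hj : j ≤ i) : Repeats T j i ↔ i - LRS T i ≤ j := by
  have h := isGreatest_LRS hi hT
  constructor
  · intro hr
    have := h.2 (show i - j ∈ {l | l ≤ i ∧ Repeats T (i - l) i} from
      ⟨by omega, by rwa [show i - (i - j) = j by omega]⟩)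
    omega
  · exact fun hle => h.1.2.mono_left hle

/-! ### The parent of the longest leaf of a suffix tree -/

/-- The last alternative is branching, which makes the common prefix of two suffixes an explicit
node. -/
theorem exists_longest_common_prefix {α : Type*} (A B : List α) :
    ∃ v, v <+: A ∧ v <+: B ∧ (∀ u, u <+: A → u <+: B → u <+: v) ∧
      (v = A ∨ v = B ∨ ∃ a b, a ≠ b ∧ v ++ [a] <+: A ∧ v ++ [b] <+: B) := by
  induction A generalizing B with
  | nil => exact ⟨[], by simp, by simp, fun u h _ => h, Or.inl rfl⟩
  | cons a A ih =>
    cases B with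
    | nil => exact ⟨[], by simp, by simp, fun u _ h => h, Or.inr (Or.inl rfl)⟩
    | cons b B =>
      by_cases hab : a = b
      · subst hab
        obtain ⟨v, h1, h2, h3, h4⟩ := ih B
        refine ⟨a :: v, by simpa using h1, by simpa using h2, ?_, ?_⟩
        · intro u hu hu'
          cases u with
          | nil => simp
          | cons c u =>
            rw [List.cons_prefix_cons] at hu hu' ⊢
            exact ⟨hu.1, h3 u hu.2 hu'.2⟩
        · simpa using h4
      · refine ⟨[], by simp, by simp, ?_, Or.inr (Or.inr ⟨a, b, hab, by simp, by simp⟩)⟩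
        intro u hu hu'
        cases u with
        | nil => simp
        | cons c u =>
          rw [List.cons_prefix_cons] at hu hu'
          exact absurd (hu.1.symm.trans hu'.1) hab

/-- A common prefix of `X.reverse` and of a later suffix of it is a repeated suffix of `X`. -/
theorem repeats_of_prefix_drop_reverse {α : Type*} {X q : List α} {d : ℕ} (hd : 0 < d)
    (h : q <+: X.reverse) (h' : q <+: X.reverse.drop d) (hd' : d + q.length ≤ X.length) :
    Repeats X (X.length - q.length) X.length := by
  refine ⟨d, hd, by omega, fun x hx hx' => ?_⟩
  have e1 := prefix_drop_iff.1 (show q <+: X.reverse.drop 0 from h) (X.length - 1 - x) (by omega)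
  have e2 := prefix_drop_iff.1 h' (X.length - 1 - x) (by omega)
  rw [← e2, List.getElem?_reverse (by omega), List.getElem?_reverse (by omega)] at e1
  rw [show X.length - 1 - (0 + (X.length - 1 - x)) = x by omega,
    show X.length - 1 - (d + (X.length - 1 - x)) = x - d by omega] at e1
  exact e1

theorem infix_iff_prefix_drop {α : Type*} {S u : List α} :
    u <:+: S ↔ ∃ p, p + u.length ≤ S.length ∧ u <+: S.drop p := by
  constructor
  · rintro ⟨s, t, rfl⟩
    exact ⟨s.length, by simp, by simp⟩
  · rintro ⟨p, -, h⟩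
    exact h.isInfix.trans (List.drop_suffix _ _).isInfix

/-- A proper prefix that is also a suffix occurs again at the end of `X.reverse`. A branching prefix
has two occurrences with different next letters, and they cannot both start at 0. Inverting turns
the repeated prefix into a repeated suffix. -/
theorem repeats_of_isSTNode {α : Type*} {X q : List α} (hq : IsSTNode X.reverse q)
    (hp : q <+: X.reverse) (hne : q ≠ X.reverse) : Repeats X (X.length - q.length) X.length := by
  have hlt : q.length < X.length := by
    have := hp.length_le
    rw [List.length_reverse] at this
    refine lt_of_le_of_ne this fun h => hne (hp.eq_of_length (by simpa using h))
  rcases hq with hs | ⟨a, b, hab, ha, hb⟩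
  · refine repeats_of_prefix_drop_reverse (d := X.length - q.length) (by omega) hp ?_ (by omega)
    have := List.suffix_iff_eq_drop.1 hs
    rw [List.length_reverse] at this
    rw [← this]
  · rw [infix_iff_prefix_drop] at ha hb
    obtain ⟨p, hpl, ha⟩ := ha
    obtain ⟨p', hpl', hb⟩ := hb
    simp only [List.length_append, List.length_reverse, List.length_cons, List.length_nil]
      at hpl hpl'
    rcases Nat.eq_zero_or_pos p with rfl | h0
    · rcases Nat.eq_zero_or_pos p' with rfl | h0'
      -- Both occurrences start at 0, so the letter after `q` would be both `a` and `b`.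
      · have e1 := prefix_drop_iff.1 ha q.length (by simp)
        have e2 := prefix_drop_iff.1 hb q.length (by simp)
        rw [e1] at e2
        simp at e2
        exact absurd e2 hab
      · exact repeats_of_prefix_drop_reverse h0' hp ((List.prefix_append _ _).trans hb) (by omega)
    · exact repeats_of_prefix_drop_reverse h0 hp ((List.prefix_append _ _).trans ha) (by omega)

/-- The node is the longest common prefix of `X.reverse` and its suffix at the shift `d` of the
repetition; it extends the repeated factor and is proper because `d > 0`. -/
theorem exists_isSTNode_of_repeats {α : Type*} {X : List α} {l : ℕ} (hl : l ≤ X.length)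
    (h : Repeats X (X.length - l) X.length) :
    ∃ q, IsSTNode X.reverse q ∧ q <+: X.reverse ∧ q ≠ X.reverse ∧ l ≤ q.length := by
  obtain ⟨d, h0, h1, h2⟩ := h
  obtain ⟨v, hv1, hv2, hv3, hv4⟩ := exists_longest_common_prefix X.reverse (X.reverse.drop d)
  have hlen : (X.reverse.take l).length = l := by simp; omega
  have hvl : v.length ≤ X.length - d := by simpa using hv2.length_le
  have hne : v ≠ X.reverse := by
    rintro rfl
    rw [List.length_reverse] at hvl
    omega
  refine ⟨v, ?_, hv1, hne, ?_⟩
  · rcases hv4 with h | h | ⟨a, b, hab, ha, hb⟩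
    · exact absurd h hne
    · exact Or.inl (h ▸ List.drop_suffix _ _)
    · exact Or.inr ⟨a, b, hab, ha.isInfix, hb.isInfix.trans (List.drop_suffix _ _).isInfix⟩
  · have := (hv3 (X.reverse.take l) (List.take_prefix _ _) ?_).length_le
    · rwa [hlen] at this
    · rw [prefix_drop_iff, hlen]
      intro x hx
      rw [List.getElem?_take_of_lt hx, List.getElem?_reverse (by omega),
        List.getElem?_reverse (by omega), h2 (X.length - 1 - x) (by omega) (by omega)]
      congr 1
      omega

/-- In the suffix tree of an inverted text, the parent of the leaf of the whole string has
string depth `LRS`. -/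
theorem exists_isSTParent_length_eq_LRS {α : Type*} {T : List α} {i : ℕ} (hi : 0 < i)
    (hT : i ≤ T.length) :
    ∃ p, IsSTParent (T.take i).reverse p (T.take i).reverse ∧ p.length = LRS T i := by
  have hlen : (T.take i).length = i := by simp; omega
  have hg := isGreatest_LRS hi hT
  have hg2 := hg.1.2
  rw [← Repeats.take_iff (le_refl i)] at hg2
  obtain ⟨p, h1, h2, h3, h4⟩ := exists_isSTNode_of_repeats (X := T.take i) (l := LRS T i)
    (by rw [hlen]; exact hg.1.1) (by rwa [hlen])
  have hle : ∀ q, IsSTNode (T.take i).reverse q → q <+: (T.take i).reverse →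
      q ≠ (T.take i).reverse → q.length ≤ LRS T i := by
    intro q k1 k2 k3
    have hr := repeats_of_isSTNode k1 k2 k3
    have := k2.length_le
    rw [List.length_reverse, hlen] at this
    rw [hlen, Repeats.take_iff le_rfl] at hr
    exact hg.2 ⟨this, hr⟩
  refine ⟨p, ⟨Or.inl List.suffix_rfl, h1, h2, h3, fun q k1 k2 k3 => ?_⟩,
    le_antisymm (hle p h1 h2 h3) h4⟩
  exact List.prefix_of_prefix_length_le k2 h2 ((hle q k1 k2 k3).trans h4)

/-! ### Values of the LPF array -/

/-- `finalBound T i` positions of the LPF array are determined by the first `i` letters. -/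
noncomputable def finalBound {α : Type*} (T : List α) (i : ℕ) : ℕ := i - LRS T i

theorem finalBound_le {α : Type*} (T : List α) (i : ℕ) : finalBound T i ≤ i := Nat.sub_le _ _

/-- The LPF value at a position that becomes determined with the `k`-th letter. -/
theorem LPF_take_eq {α : Type*} {T : List α} {i j k : ℕ} (hT : i ≤ T.length) (hk : k ≤ i)
    (hj : j < finalBound T k) (hmin : ∀ k' < k, finalBound T k' ≤ j) :
    LPF (T.take i) j = k - 1 - j := by
  have hjk : j < k := hj.trans_le (finalBound_le T k)
  have hlen : (T.take i).length = i := by simp; omega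
  rcases Nat.eq_zero_or_pos (k - 1) with h0 | h0
  · obtain rfl : j = 0 := by omega
    rw [LPF_zero]
    omega
  -- The factor from `j` is still repeated at letter `k - 1` by `hmin`, and no longer at letter `k`
  -- by `hj`.
  · refine LPF_eq_of_repeats (by omega) (by omega) ?_ fun _ => ?_
    · rw [Repeats.take_iff (by omega), repeats_iff_LRS h0 (by omega) (by omega)]
      exact hmin _ (by omega)
    · rw [show k - 1 + 1 = k by omega, Repeats.take_iff hk,
        repeats_iff_LRS (by omega) (by omega) hjk.le]
      exact not_le.2 hj

/-- The LPF value, in the prefix of length `i`, at a position that it does not determine. -/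
theorem LPF_take_eq_of_finalBound_le {α : Type*} {T : List α} {i j : ℕ} (hT : i ≤ T.length)
    (hji : j < i) (hj : finalBound T i ≤ j) : LPF (T.take i) j = i - j := by
  have hlen : (T.take i).length = i := by simp; omega
  refine LPF_eq_of_repeats hji.le hlen.ge ?_ fun h => absurd h (by omega)
  rw [Repeats.take_iff le_rfl, repeats_iff_LRS (by omega) hT hji.le]
  exact hj

theorem maxLRS_mono {α : Type*} (T : List α) {i i' : ℕ} (h : i ≤ i') : maxLRS T i ≤ maxLRS T i' :=
  Finset.sup_mono (Finset.Icc_subset_Icc_right h)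

theorem LRS_le_maxLRS {α : Type*} (T : List α) {i : ℕ} (hi : 0 < i) : LRS T i ≤ maxLRS T i :=
  Finset.le_sup (f := LRS T) (Finset.mem_Icc.2 ⟨hi, le_rfl⟩)

/-! ### Running a program next to unrelated registers and arrays -/

/-- A strict upper bound for the registers in a test. -/
def Test.idBound : Test → ℕ
  | .eq a b => max a b + 1
  | .lt a b => max a b + 1

/-- A strict upper bound for the registers and arrays in a program. -/
def Cmd.idBound : Cmd → ℕ
  | .skip => 0
  | .const d _ => d + 1
  | .copy d a => max d a + 1
  | .op _ d a b => max d (max a b) + 1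
  | .load d A a => max d (max A a) + 1
  | .store A a b => max A (max a b) + 1
  | .seq p q => max p.idBound q.idBound
  | .ite b p q => max b.idBound (max p.idBound q.idBound)
  | .loop b p => max b.idBound p.idBound

/-- The memories agree on all registers and arrays with numbers below `N`. -/
structure Agree {w : ℕ} (N : ℕ) (s t : State w) : Prop where
  reg : ∀ r < N, t.reg r = s.reg r
  arr : ∀ A < N, t.arr A = s.arr A

theorem Agree.refl {w : ℕ} (N : ℕ) (s : State w) : Agree N s s := ⟨fun _ _ => rfl, fun _ _ => rfl⟩

theorem Agree.trans {w N : ℕ} {s t u : State w} (h : Agree N s t) (h' : Agree N t u) :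
    Agree N s u :=
  ⟨fun r hr => (h'.reg r hr).trans (h.reg r hr), fun A hA => (h'.arr A hA).trans (h.arr A hA)⟩

theorem Agree.holds_iff {w N : ℕ} {s t : State w} (h : Agree N s t) {b : Test}
    (hb : b.idBound ≤ N) : b.holds t ↔ b.holds s := by
  cases b with
  | eq x y =>
    simp only [Test.idBound] at hb
    simp only [Test.holds, h.reg x (by omega), h.reg y (by omega)]
  | lt x y =>
    simp only [Test.idBound] at hb
    simp only [Test.holds, h.reg x (by omega), h.reg y (by omega)]

theorem Agree.setReg {w N : ℕ} {s t : State w} (h : Agree N s t) (d : ℕ) (x : BitVec w) :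
    Agree N (s.setReg d x) (t.setReg d x) := by
  refine ⟨fun r hr => ?_, h.arr⟩
  simp only [State.setReg, Function.update_apply, h.reg r hr]

/-- The registers and arrays with numbers from `N` on are unchanged from `t` to `t'`, which
accesses no more array cells than `s'` if `t` accesses no more than `s`. -/
structure Untouched {w : ℕ} (N : ℕ) (s t s' t' : State w) : Prop where
  reg : ∀ r, N ≤ r → t'.reg r = t.reg r
  arr : ∀ A, N ≤ A → t'.arr A = t.arr A
  used : ∀ E, t.used ⊆ s.used ∪ E → t'.used ⊆ s'.used ∪ E

theorem Untouched.trans {w N : ℕ} {s t s' t' s'' t'' : State w} (h : Untouched N s t s' t')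
    (h' : Untouched N s' t' s'' t'') : Untouched N s t s'' t'' :=
  ⟨fun r hr => (h'.reg r hr).trans (h.reg r hr), fun A hA => (h'.arr A hA).trans (h.arr A hA),
    fun E hE => h'.used E (h.used E hE)⟩

/-- A program runs in the same way in memories that agree on its registers and arrays. -/
theorem Exec.simulate {w N : ℕ} {p : Cmd} {s s' : State w} {c : ℕ} (h : Exec p s s' c)
    (hp : p.idBound ≤ N) (t : State w) (hst : Agree N s t) :
    ∃ t', Exec p t t' c ∧ Agree N s' t' ∧ Untouched N s t s' t' := by
  induction h generalizing t with
  | skip s => exact ⟨t, .skip t, hst, fun _ _ => rfl, fun _ _ => rfl, fun _ h => h⟩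
  | const s d v =>
    simp only [Cmd.idBound] at hp
    exact ⟨_, .const t d v, hst.setReg _ _, fun r hr => Function.update_of_ne (by omega) _ _,
      fun _ _ => rfl, fun _ h => h⟩
  | copy s d a =>
    simp only [Cmd.idBound] at hp
    refine ⟨_, .copy t d a, ?_, fun r hr => Function.update_of_ne (by omega) _ _,
      fun _ _ => rfl, fun _ h => h⟩
    rw [hst.reg a (by omega)]
    exact hst.setReg _ _
  | op s o d a b =>
    simp only [Cmd.idBound] at hp
    refine ⟨_, .op t o d a b, ?_, fun r hr => Function.update_of_ne (by omega) _ _,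
      fun _ _ => rfl, fun _ h => h⟩
    rw [hst.reg a (by omega), hst.reg b (by omega)]
    exact hst.setReg _ _
  | load s d A a =>
    simp only [Cmd.idBound] at hp
    refine ⟨_, .load t d A a, ⟨?_, hst.arr⟩, fun r hr => Function.update_of_ne (by omega) _ _,
      fun _ _ => rfl, fun E hE => ?_⟩
    · have := (hst.setReg d (s.arr A (s.reg a))).reg
      simp only [State.load, hst.reg a (by omega), hst.arr A (by omega)]
      exact this
    · simp only [State.load, hst.reg a (by omega), Finset.insert_union]
      exact Finset.insert_subset_insert _ hE
  | store s A a b =>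
    simp only [Cmd.idBound] at hp
    refine ⟨_, .store t A a b, ⟨hst.reg, fun B hB => ?_⟩, fun _ _ => rfl,
      fun B hB => Function.update_of_ne (by omega) _ _, fun E hE => ?_⟩
    · simp only [State.store, Function.update_apply, hst.reg a (by omega), hst.reg b (by omega),
        hst.arr A (by omega), hst.arr B hB]
    · simp only [State.store, hst.reg a (by omega), Finset.insert_union]
      exact Finset.insert_subset_insert _ hE
  | seq _ _ ih1 ih2 =>
    simp only [Cmd.idBound] at hp
    obtain ⟨t1, e1, a1, u1⟩ := ih1 (by omega) t hst
    obtain ⟨t2, e2, a2, u2⟩ := ih2 (by omega) t1 a1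
    exact ⟨t2, .seq e1 e2, a2, u1.trans u2⟩
  | ite_true hb _ ih =>
    simp only [Cmd.idBound] at hp
    obtain ⟨t1, e1, a1, u1⟩ := ih (by omega) t hst
    exact ⟨t1, .ite_true ((hst.holds_iff (by omega)).2 hb) e1, a1, u1⟩
  | ite_false hb _ ih =>
    simp only [Cmd.idBound] at hp
    obtain ⟨t1, e1, a1, u1⟩ := ih (by omega) t hst
    exact ⟨t1, .ite_false (fun h => hb ((hst.holds_iff (by omega)).1 h)) e1, a1, u1⟩
  | loop_done hb =>
    simp only [Cmd.idBound] at hp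
    exact ⟨t, .loop_done (fun h => hb ((hst.holds_iff (by omega)).1 h)), hst,
      fun _ _ => rfl, fun _ _ => rfl, fun _ h => h⟩
  | loop_step hb _ _ ih1 ih2 =>
    have hp' := hp
    simp only [Cmd.idBound] at hp'
    obtain ⟨t1, e1, a1, u1⟩ := ih1 (by omega) t hst
    obtain ⟨t2, e2, a2, u2⟩ := ih2 hp t1 a1
    exact ⟨t2, .loop_step ((hst.holds_iff (by omega)).2 hb) e1 e2, a2, u1.trans u2⟩

/-! ### The online LPF algorithm

The registers `N, …, N + 5` hold the number `i` of letters read, the number `d` of values computed,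
a number `k ≤ i`, the constant `1`, and two temporary values. Array `N` holds `finalBound T` and
array `N + 1` the output. -/

/-- Write the next value, which became determined with the `k`-th letter, as soon as `k` is that
letter; otherwise increase `k`, and run `last` if `k` is maximal. -/
def advance (N : ℕ) (last : Cmd) : Cmd :=
  .seq (.load (N + 4) N (N + 2)) <|
    .ite (.lt (N + 1) (N + 4))
      (.seq (.op .sub (N + 5) (N + 2) (N + 1)) <| .seq (.op .sub (N + 5) (N + 5) (N + 3)) <|
        .seq (.store (N + 1) (N + 1) (N + 5)) (.op .add (N + 1) (N + 1) (N + 3)))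
      (.ite (.lt (N + 2) N) (.op .add (N + 2) (N + 2) (N + 3)) last)

/-- Write the next value at the end of the text, where it is not determined by any letter. -/
def emitLast (N : ℕ) : Cmd :=
  .seq (.op .sub (N + 5) N (N + 1)) <|
    .seq (.store (N + 1) (N + 1) (N + 5)) (.op .add (N + 1) (N + 1) (N + 3))

/-- The part of a round after the update of the suffix tree. -/
def afterUpdate (P : SuffixTreeAlg) (N : ℕ) : Cmd :=
  .seq (.const (N + 3) 1) <| .seq (.op .add N N (N + 3)) <|
    .seq (.load (N + 4) P.lenArr P.leafReg) <| .seq (.store N N (N + 4)) <|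
      -- Two steps, because both pointers have to keep up with `i`.
      .seq (advance N .skip) (advance N .skip)

def lpfAlg (P : SuffixTreeAlg) (N : ℕ) : LPFAlg where
  prog := .seq P.prog (afterUpdate P N)
  finish := .loop (.lt (N + 1) N) (advance N (emitLast N))
  lpfArr := N + 1
  doneReg := N + 1

/-- The cells with indices up to `i` of the arrays `N` and `N + 1`. -/
def ownCells (w N i : ℕ) : Finset (ℕ × BitVec w) :=
  ({N, N + 1} : Finset ℕ) ×ˢ (Finset.range (i + 1)).image (BitVec.ofNat w)

theorem card_ownCells_le (w N i : ℕ) : (ownCells w N i).card ≤ 2 * (i + 1) := by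
  rw [ownCells, Finset.card_product]
  exact Nat.mul_le_mul Finset.card_le_two (Finset.card_image_le.trans (by simp))

theorem mem_ownCells {w N i j A : ℕ} (hA : A = N ∨ A = N + 1) (hj : j ≤ i) :
    (A, BitVec.ofNat w j) ∈ ownCells w N i := by
  simp only [ownCells, Finset.mem_product, Finset.mem_insert, Finset.mem_singleton,
    Finset.mem_image, Finset.mem_range]
  exact ⟨hA, j, by omega, rfl⟩

theorem ownCells_mono (w N : ℕ) {i i' : ℕ} (h : i ≤ i') : ownCells w N i ⊆ ownCells w N i' :=
  Finset.product_subset_product_right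
    (Finset.image_subset_image (Finset.range_subset_range.2 (by omega)))

/-! ### Natural numbers below `2 ^ w` as words -/

theorem BitVec.ofNat_sub_of_le {w a b : ℕ} (h : b ≤ a) :
    BitVec.ofNat w a - BitVec.ofNat w b = BitVec.ofNat w (a - b) := by
  rw [sub_eq_iff_eq_add, ← BitVec.ofNat_add, Nat.sub_add_cancel h]

theorem BitVec.toNat_ofNat_of_lt' {w a : ℕ} (h : a < 2 ^ w) : (BitVec.ofNat w a).toNat = a := by
  rw [BitVec.toNat_ofNat, Nat.mod_eq_of_lt h]

theorem BitVec.ofNat_ne {w a b : ℕ} (ha : a < 2 ^ w) (hb : b < 2 ^ w) (h : a ≠ b) :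
    BitVec.ofNat w a ≠ BitVec.ofNat w b := fun he => h <| by
  rw [← BitVec.toNat_ofNat_of_lt' ha, he, BitVec.toNat_ofNat_of_lt' hb]

/-- The memory of the LPF algorithm after `i` letters, with `d` values written which are final for
all prefixes of `T` of lengths from `i` to `m`, and with only cells of `B` and own cells accessed. -/
structure LPFMemory {w σ : ℕ} (N : ℕ) (T : List (Fin σ)) (m : ℕ) (B : Finset (ℕ × BitVec w))
    (i d k : ℕ) (s : State w) : Prop where
  regI : s.reg N = BitVec.ofNat w i
  regD : s.reg (N + 1) = BitVec.ofNat w d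
  regK : s.reg (N + 2) = BitVec.ofNat w k
  one : 0 < i → s.reg (N + 3) = BitVec.ofNat w 1
  bound : ∀ j ≤ i, s.arr N (BitVec.ofNat w j) = BitVec.ofNat w (finalBound T j)
  val : ∀ m', i ≤ m' → m' ≤ m → ∀ j < d,
    s.arr (N + 1) (BitVec.ofNat w j) = BitVec.ofNat w (LPF (T.take m') j)
  used : s.used ⊆ B ∪ ownCells w N i
  d_le : d ≤ i
  k_le : k ≤ i
  past : ∀ k' < k, finalBound T k' ≤ d

namespace LPFMemory

variable {w σ N : ℕ} {T : List (Fin σ)} {m : ℕ} {B : Finset (ℕ × BitVec w)} {i d k : ℕ}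
  {s : State w}

theorem load_bound (h : LPFMemory N T m B i d k s) :
    LPFMemory N T m B i d k (s.load (N + 4) N (N + 2)) where
  regI := by simpa [State.load, Function.update_apply] using h.regI
  regD := by simpa [State.load, Function.update_apply] using h.regD
  regK := by simpa [State.load, Function.update_apply] using h.regK
  one := by simpa [State.load, Function.update_apply] using h.one
  bound := h.bound
  val := h.val
  used := by
    refine Finset.insert_subset ?_ h.used
    rw [h.regK]
    exact Finset.mem_union_right _ (mem_ownCells (Or.inl rfl) h.k_le)
  d_le := h.d_le
  k_le := h.k_le
  past := h.past

theorem reg_load_bound (h : LPFMemory N T m B i d k s) :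
    (s.load (N + 4) N (N + 2)).reg (N + 4) = BitVec.ofNat w (finalBound T k) := by
  simp [State.load, h.regK, h.bound k h.k_le]

theorem incr_k (h : LPFMemory N T m B i d k s) (hk : k < i) (hd : finalBound T k ≤ d) :
    LPFMemory N T m B i d (k + 1)
      (s.setReg (N + 2) (Op.add.eval (s.reg (N + 2)) (s.reg (N + 3)))) where
  regI := by simpa [State.setReg, Function.update_apply] using h.regI
  regD := by simpa [State.setReg, Function.update_apply] using h.regD
  regK := by
    simp [State.setReg, h.regK, h.one (by omega), Op.eval, BitVec.ofNat_add]
  one := by simpa [State.setReg, Function.update_apply] using h.one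
  bound := h.bound
  val := h.val
  used := h.used
  d_le := h.d_le
  k_le := hk
  past := fun k' hk' => by
    rcases Nat.lt_succ_iff_lt_or_eq.1 hk' with h' | rfl
    · exact h.past k' h'
    · exact hd

theorem setReg_tmp (h : LPFMemory N T m B i d k s) (x : BitVec w) :
    LPFMemory N T m B i d k (s.setReg (N + 5) x) where
  regI := by simpa [State.setReg, Function.update_apply] using h.regI
  regD := by simpa [State.setReg, Function.update_apply] using h.regD
  regK := by simpa [State.setReg, Function.update_apply] using h.regK
  one := by simpa [State.setReg, Function.update_apply] using h.one
  bound := h.bound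
  val := h.val
  used := h.used
  d_le := h.d_le
  k_le := h.k_le
  past := h.past

theorem emit (h : LPFMemory N T m B i d k s) (hw : i < 2 ^ w) (hd : d < i)
    (hv : ∀ m', i ≤ m' → m' ≤ m → s.reg (N + 5) = BitVec.ofNat w (LPF (T.take m') d)) :
    ∃ s', Exec (.seq (.store (N + 1) (N + 1) (N + 5)) (.op .add (N + 1) (N + 1) (N + 3))) s s' 2 ∧
      LPFMemory N T m B i (d + 1) k s' ∧ Agree N s s' := by
  refine ⟨_, .seq (.store _ _ _ _) (.op _ _ _ _ _), ?_, ?_⟩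
  · exact
    { regI := by simpa [State.setReg, State.store, Function.update_apply] using h.regI
      regD := by
        simp [State.setReg, State.store, h.regD, h.one (by omega), Op.eval, BitVec.ofNat_add]
      regK := by simpa [State.setReg, State.store, Function.update_apply] using h.regK
      one := by simpa [State.setReg, State.store, Function.update_apply] using h.one
      bound := by simpa [State.setReg, State.store, Function.update_apply] using h.bound
      val := by
        intro m' h1 h2 j hj
        simp only [State.setReg, State.store, Function.update_self, h.regD]
        rcases Nat.lt_succ_iff_lt_or_eq.1 hj with hj | rfl
        · rw [Function.update_of_ne (BitVec.ofNat_ne (by omega) (by omega) (by omega))]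
          exact h.val m' h1 h2 j hj
        · rw [Function.update_self]
          exact hv m' h1 h2
      used := by
        refine Finset.insert_subset ?_ h.used
        rw [h.regD]
        exact Finset.mem_union_right _ (mem_ownCells (Or.inr rfl) h.d_le)
      d_le := hd
      k_le := h.k_le
      past := fun k' hk' => (h.past k' hk').trans (Nat.le_succ d) }
  · refine ⟨fun r hr => ?_, fun A hA => ?_⟩
    · exact Function.update_of_ne (by omega) _ _
    · exact Function.update_of_ne (by omega) _ _

end LPFMemory

theorem agree_setReg {w N d : ℕ} (s : State w) (x : BitVec w) (hd : N ≤ d) :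
    Agree N s (s.setReg d x) :=
  ⟨fun _ hr => Function.update_of_ne (by omega) _ _, fun _ _ => rfl⟩

theorem agree_load {w N d A a : ℕ} (s : State w) (hd : N ≤ d) : Agree N s (s.load d A a) :=
  ⟨fun _ hr => Function.update_of_ne (by omega) _ _, fun _ _ => rfl⟩

theorem agree_store {w N A a b : ℕ} (s : State w) (hA : N ≤ A) : Agree N s (s.store A a b) :=
  ⟨fun _ _ => rfl, fun _ hB => Function.update_of_ne (by omega) _ _⟩

/-! ### Cost and effect of one pointer step and of the completion -/

namespace LPFMemory

variable {w σ N : ℕ} {T : List (Fin σ)} {m : ℕ} {B : Finset (ℕ × BitVec w)} {i d k : ℕ}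
  {s : State w}

/-- The field `past` says that no letter before `k` determines position `d`, so `LPF_take_eq` gives
the same value for all later prefixes. -/
theorem exec_advance_emit (h : LPFMemory N T m B i d k s) (hw : T.length < 2 ^ w)
    (hm : m ≤ T.length) (hi : i ≤ T.length) (last : Cmd) (hd : d < finalBound T k) :
    ∃ s', Exec (advance N last) s s' 6 ∧ LPFMemory N T m B i (d + 1) k s' ∧ Agree N s s' := by
  have hk := h.k_le
  have hdk := hd.trans_le (finalBound_le T k)
  have h1 := h.load_bound
  have hq := h.reg_load_bound
  set s1 := s.load (N + 4) N (N + 2) with hs1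
  have h2 := h1.setReg_tmp (Op.sub.eval (s1.reg (N + 2)) (s1.reg (N + 1)))
  set s2 := s1.setReg (N + 5) (Op.sub.eval (s1.reg (N + 2)) (s1.reg (N + 1))) with hs2
  have h3 := h2.setReg_tmp (Op.sub.eval (s2.reg (N + 5)) (s2.reg (N + 3)))
  set s3 := s2.setReg (N + 5) (Op.sub.eval (s2.reg (N + 5)) (s2.reg (N + 3))) with hs3
  have hv : s3.reg (N + 5) = BitVec.ofNat w (k - 1 - d) := by
    have e : s2.reg (N + 5) = BitVec.ofNat w (k - d) := by
      simp only [hs2, State.setReg, Function.update_self, Op.eval, h1.regK, h1.regD]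
      exact BitVec.ofNat_sub_of_le hdk.le
    simp only [hs3, State.setReg, Function.update_self, Op.eval, e, h2.one (by omega)]
    rw [BitVec.ofNat_sub_of_le (by omega)]
    congr 1
    omega
  obtain ⟨s', e, h4, a⟩ := h3.emit (by omega) (by omega) fun m' hm' hm'' => by
    rw [hv, LPF_take_eq (by omega) (by omega) hd h.past]
  refine ⟨s', .seq (.load _ _ _ _) (.ite_true ?_ (.seq (.op _ _ _ _ _) (.seq (.op _ _ _ _ _) e))),
    h4, (((agree_load s (by omega)).trans (agree_setReg _ _ (by omega))).trans
      (agree_setReg _ _ (by omega))).trans a⟩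
  change (s1.reg (N + 1)).toNat < (s1.reg (N + 4)).toNat
  rw [h1.regD, hq, BitVec.toNat_ofNat_of_lt' (by omega), BitVec.toNat_ofNat_of_lt']
  · exact hd
  · have := finalBound_le T k
    omega

theorem exec_advance_incr (h : LPFMemory N T m B i d k s) (hw : T.length < 2 ^ w)
    (hi : i ≤ T.length) (last : Cmd) (hd : finalBound T k ≤ d) (hk : k < i) :
    ∃ s', Exec (advance N last) s s' 4 ∧ LPFMemory N T m B i d (k + 1) s' ∧ Agree N s s' := by
  have hdi := h.d_le
  have h1 := h.load_bound
  refine ⟨_, .seq (.load _ _ _ _) (.ite_false ?_ (.ite_true ?_ (.op _ _ _ _ _))),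
    h1.incr_k hk hd, (agree_load s (by omega)).trans (agree_setReg _ _ (by omega))⟩
  · simp only [Test.holds]
    rw [h1.regD, h.reg_load_bound, BitVec.toNat_ofNat_of_lt' (by omega),
      BitVec.toNat_ofNat_of_lt' (by omega)]
    omega
  · simp only [Test.holds]
    rw [h1.regK, h1.regI, BitVec.toNat_ofNat_of_lt' (by omega),
      BitVec.toNat_ofNat_of_lt' (by omega)]
    exact hk

theorem exec_advance_last (h : LPFMemory N T m B i d k s) (hw : T.length < 2 ^ w)
    (hi : i ≤ T.length) {last : Cmd} (hd : finalBound T k ≤ d) (hk : k = i) {s' : State w} {c : ℕ}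
    (he : Exec last (s.load (N + 4) N (N + 2)) s' c) : Exec (advance N last) s s' (c + 3) := by
  have hdi := h.d_le
  have h1 := h.load_bound
  have e : 1 + (c + 1 + 1) = c + 3 := by omega
  refine e ▸ .seq (.load _ _ _ _) (.ite_false ?_ (.ite_false ?_ he))
  · simp only [Test.holds]
    rw [h1.regD, h.reg_load_bound, BitVec.toNat_ofNat_of_lt' (by omega),
      BitVec.toNat_ofNat_of_lt' (by omega)]
    omega
  · simp only [Test.holds]
    rw [h1.regK, h1.regI, hk]
    omega

/-- One step of the pointers `d` and `k` makes progress unless all determined values are written. -/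
theorem exec_advance_skip (h : LPFMemory N T m B i d k s) (hw : T.length < 2 ^ w)
    (hm : m ≤ T.length) (hi : i ≤ T.length) (hdk : d ≤ k) :
    ∃ s' c d' k', Exec (advance N .skip) s s' c ∧ c ≤ 6 ∧ LPFMemory N T m B i d' k' s' ∧
      Agree N s s' ∧ d ≤ d' ∧ k ≤ k' ∧ d' ≤ k' ∧
      (d + k + 1 ≤ d' + k' ∨ k' = i ∧ finalBound T i ≤ d') := by
  by_cases hd : d < finalBound T k
  · obtain ⟨s', e, h', a⟩ := h.exec_advance_emit hw hm hi .skip hd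
    have := finalBound_le T k
    exact ⟨s', 6, d + 1, k, e, le_rfl, h', a, by omega, le_rfl, by omega, Or.inl (by omega)⟩
  · rw [not_lt] at hd
    rcases h.k_le.lt_or_eq with hk | hk
    · obtain ⟨s', e, h', a⟩ := h.exec_advance_incr hw hi .skip hd hk
      exact ⟨s', 4, d, k + 1, e, by omega, h', a, le_rfl, by omega, by omega, Or.inl (by omega)⟩
    · exact ⟨_, _, d, k, h.exec_advance_last hw hi hd hk (.skip _), by omega, h.load_bound,
        agree_load s (by omega), le_rfl, le_rfl, hdk, Or.inr ⟨hk, hk ▸ hd⟩⟩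

theorem exec_emitLast (h : LPFMemory N T i B i d k s) (hw : T.length < 2 ^ w)
    (hi : i ≤ T.length) (hd : finalBound T i ≤ d) (hdi : d < i) :
    ∃ s', Exec (emitLast N) s s' 3 ∧ LPFMemory N T i B i (d + 1) k s' := by
  have h1 := h.setReg_tmp (Op.sub.eval (s.reg N) (s.reg (N + 1)))
  obtain ⟨s', e, h2, -⟩ := h1.emit (by omega) hdi fun m' hm' hm'' => by
    obtain rfl : m' = i := by omega
    simp only [State.setReg, Function.update_self, Op.eval, h.regI, h.regD]
    rw [LPF_take_eq_of_finalBound_le hi hdi hd, BitVec.ofNat_sub_of_le hdi.le]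
  exact ⟨s', .seq (.op _ _ _ _ _) e, h2⟩

/-- The potential `2 * i - d - k` drops by one in each iteration, which costs one test and at most 6
further steps. -/
theorem exec_finish (h : LPFMemory N T i B i d k s) (hw : T.length < 2 ^ w)
    (hi : i ≤ T.length) :
    ∃ s' c k', Exec (.loop (.lt (N + 1) N) (advance N (emitLast N))) s s' c ∧
      c ≤ 7 * (2 * i - d - k) + 1 ∧ LPFMemory N T i B i i k' s' := by
  have hk := h.k_le
  have hlt : Test.holds s (.lt (N + 1) N) ↔ d < i := by
    have hd := h.d_le
    simp only [Test.holds]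
    rw [h.regD, h.regI, BitVec.toNat_ofNat_of_lt' (by omega), BitVec.toNat_ofNat_of_lt' (by omega)]
  generalize hf : 2 * i - d - k = f
  induction f generalizing d k s with
  | zero =>
    have hd := h.d_le
    obtain rfl : d = i := by omega
    exact ⟨s, 1, k, .loop_done (by rw [hlt]; omega), by omega, h⟩
  | succ f ih =>
    have lt_of (d k s) (h : LPFMemory N T i B i d k s) :
        Test.holds s (.lt (N + 1) N) ↔ d < i := by
      have hd := h.d_le
      simp only [Test.holds]
      rw [h.regD, h.regI, BitVec.toNat_ofNat_of_lt' (by omega),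
        BitVec.toNat_ofNat_of_lt' (by omega)]
    rcases h.d_le.eq_or_lt with rfl | hdi
    · exact ⟨s, 1, k, .loop_done (by rw [hlt]; omega), by omega, h⟩
    · obtain ⟨s1, c1, d1, k1, e1, hc1, h1, hf1⟩ : ∃ s1 c1 d1 k1,
          Exec (advance N (emitLast N)) s s1 c1 ∧ c1 ≤ 6 ∧ LPFMemory N T i B i d1 k1 s1 ∧
            2 * i - d1 - k1 = f := by
        by_cases hd : d < finalBound T k
        · obtain ⟨s', e, h', -⟩ := h.exec_advance_emit hw hi hi (emitLast N) hd
          exact ⟨s', _, _, _, e, by omega, h', by omega⟩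
        · rw [not_lt] at hd
          rcases hk.lt_or_eq with hk | hk
          · obtain ⟨s', e, h', -⟩ := h.exec_advance_incr hw hi (emitLast N) hd hk
            exact ⟨s', _, _, _, e, by omega, h', by omega⟩
          · obtain ⟨s', e, h'⟩ := h.load_bound.exec_emitLast hw hi (hk ▸ hd) hdi
            exact ⟨s', _, _, _, h.exec_advance_last hw hi hd hk e, by omega, h', by omega⟩
      obtain ⟨s', c, k', e, hc, h'⟩ := ih h1 h1.k_le (lt_of _ _ _ h1) hf1
      exact ⟨s', _, k', .loop_step (hlt.2 hdi) e1 e, by omega, h'⟩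

end LPFMemory

/-- If `P` holds the suffix tree of the inverted text, the edge to the leaf of the whole string has
length `finalBound`. -/
theorem HoldsSuffixTree.lenArr_leaf {w σ : ℕ} {P : SuffixTreeAlg} {s : State w} {T : List (Fin σ)}
    {i : ℕ} (h : HoldsSuffixTree P s (T.take i)) (hi : 0 < i) (hT : i ≤ T.length) :
    s.arr P.lenArr (s.reg P.leafReg) = BitVec.ofNat w (finalBound T i) := by
  obtain ⟨ν, -, -, hleaf, hν⟩ := h
  obtain ⟨p, hp, hpl⟩ := exists_isSTParent_length_eq_LRS hi hT
  have := (hν _ _ hp).2.1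
  rw [List.length_reverse, List.length_take, hpl, min_eq_left hT] at this
  rw [hleaf, finalBound, ← this, BitVec.ofNat_toNat, BitVec.setWidth_eq]

/-- The relation between the memory `t` of the LPF algorithm and the memory `s` of the suffix tree
algorithm after `i` letters. -/
structure RoundInv {w σ : ℕ} (N : ℕ) (T : List (Fin σ)) (i d k : ℕ) (E : Finset (ℕ × BitVec w))
    (s t : State w) : Prop where
  agree : Agree N s t
  mem : LPFMemory N T T.length (s.used ∪ E) i d k t
  card_le : E.card ≤ i
  le : d ≤ k
  pace : 2 * i ≤ d + k + maxLRS T i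

/-! ### The round invariant: start, preservation and completion -/

theorem RoundInv.start {w σ N : ℕ} (hN : 3 ≤ N) (T : List (Fin σ)) :
    RoundInv N T 0 0 0 ∅ (State.start w σ) (State.start w σ) where
  agree := .refl _ _
  mem :=
    { regI := by
        simp only [State.start]
        rw [if_neg (by omega), if_neg (by omega)]
        rfl
      regD := by
        simp only [State.start]
        rw [if_neg (by omega), if_neg (by omega)]
        rfl
      regK := by
        simp only [State.start]
        rw [if_neg (by omega), if_neg (by omega)]
        rfl
      one := fun h => absurd h (by omega)
      -- Truncated subtraction gives `finalBound T 0 = 0`, so the zeroed array is already correct.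
      bound := fun j hj => by
        obtain rfl : j = 0 := by omega
        simp [State.start, finalBound]
      val := fun _ _ _ j hj => absurd hj (by omega)
      used := by simp [State.start]
      d_le := le_rfl
      k_le := le_rfl
      past := fun _ h => absurd h (by omega) }
  card_le := by simp
  le := le_rfl
  pace := by omega

/-- The rest `p` of the round is a parameter because sequencing nests to the right. The cell read
for the leaf edge is charged to `B`, since `P` need not have accessed it. -/
theorem LPFMemory.exec_read {w σ N : ℕ} {T : List (Fin σ)} {m : ℕ} {B : Finset (ℕ × BitVec w)}
    {i d k : ℕ} {s : State w} (h : LPFMemory N T m B i d k s) (hi : i + 1 < 2 ^ w)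
    {A a : ℕ} (hA : A < N) (ha : a < N)
    (hb : s.arr A (s.reg a) = BitVec.ofNat w (finalBound T (i + 1))) (p : Cmd) :
    ∃ s', LPFMemory N T m (insert (A, s.reg a) B) (i + 1) d k s' ∧ Agree N s s' ∧
      ∀ s'' c, Exec p s' s'' c → Exec (.seq (.const (N + 3) 1) <| .seq (.op .add N N (N + 3)) <|
        .seq (.load (N + 4) A a) <| .seq (.store N N (N + 4)) p) s s'' (c + 4) := by
  set s1 := s.setReg (N + 3) (BitVec.ofNat w 1) with hs1
  set s2 := s1.setReg N (Op.add.eval (s1.reg N) (s1.reg (N + 3))) with hs2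
  set s3 := s2.load (N + 4) A a with hs3
  have regI : s2.reg N = BitVec.ofNat w (i + 1) := by
    simp [hs2, hs1, State.setReg, h.regI, Op.eval, BitVec.ofNat_add]
  have regI3 : s3.reg N = BitVec.ofNat w (i + 1) := by
    simpa [hs3, State.load, Function.update_apply] using regI
  have ag2 : Agree N s s2 := (agree_setReg s _ (by omega)).trans (agree_setReg s1 _ le_rfl)
  have regQ : s3.reg (N + 4) = BitVec.ofNat w (finalBound T (i + 1)) := by
    simp only [hs3, State.load, Function.update_self, ag2.reg a ha, ag2.arr A hA, hb]
  have one : s2.reg (N + 3) = BitVec.ofNat w 1 := by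
    simp [hs2, hs1, State.setReg]
  refine ⟨s3.store N N (N + 4), ?_, ?_, fun s'' c hc => ?_⟩
  · exact
    { regI := regI3
      regD := by
        simpa [State.store, hs3, hs2, hs1, State.load, State.setReg, Function.update_apply]
          using h.regD
      regK := by
        simpa [State.store, hs3, hs2, hs1, State.load, State.setReg, Function.update_apply]
          using h.regK
      one := fun _ => by simpa [State.store, hs3, State.load, Function.update_apply] using one
      bound := fun j hj => by
        simp only [State.store, Function.update_self, regI3, regQ]
        rcases hj.eq_or_lt with rfl | hj
        · rw [Function.update_self]
        · rw [Function.update_of_ne (BitVec.ofNat_ne (by omega) hi hj.ne)]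
          exact h.bound j (by omega)
      val := fun m' h1 h2 j hj => by
        simp only [State.store, Function.update_of_ne (Nat.succ_ne_self N)]
        exact h.val m' (by omega) h2 j hj
      used := by
        have hN : (N, s3.reg N) ∈ ownCells w N (i + 1) := regI3 ▸ mem_ownCells (Or.inl rfl) le_rfl
        refine Finset.insert_subset (Finset.mem_union_right _ hN) ?_
        simp only [hs3, State.load]
        rw [ag2.reg a ha, Finset.insert_union]
        exact Finset.insert_subset_insert _
          (h.used.trans (Finset.union_subset_union_right (ownCells_mono w N (Nat.le_succ i))))
      d_le := h.d_le.trans (Nat.le_succ i)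
      k_le := h.k_le.trans (Nat.le_succ i)
      past := h.past }
  · exact (ag2.trans (agree_load s2 (by omega))).trans (agree_store s3 le_rfl)
  · have e : 1 + (1 + (1 + (1 + c))) = c + 4 := by omega
    exact e ▸ .seq (.const _ _ _) (.seq (.op _ _ _ _ _) (.seq (.load _ _ _ _)
      (.seq (.store _ _ _ _) hc)))

/-- Running `P` leaves everything numbered from `N` on alone; any new cells are ones that `P` itself
accesses. -/
theorem LPFMemory.of_untouched {w σ N : ℕ} {T : List (Fin σ)} {m : ℕ}
    {E : Finset (ℕ × BitVec w)} {i d k : ℕ} {s t s' t' : State w}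
    (h : LPFMemory N T m (s.used ∪ E) i d k t) (hu : Untouched N s t s' t') :
    LPFMemory N T m (s'.used ∪ E) i d k t' where
  regI := (hu.reg _ (by omega)).trans h.regI
  regD := (hu.reg _ (by omega)).trans h.regD
  regK := (hu.reg _ (by omega)).trans h.regK
  one := fun hi => (hu.reg _ (by omega)).trans (h.one hi)
  bound := by rw [hu.arr _ le_rfl]; exact h.bound
  val := by rw [hu.arr _ (by omega)]; exact h.val
  used := by
    have := h.used
    rw [Finset.union_assoc] at this ⊢
    exact hu.used _ this
  d_le := h.d_le
  k_le := h.k_le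
  past := h.past

theorem LPFMemory.setReg_input {w σ N : ℕ} {T : List (Fin σ)} {m : ℕ}
    {B : Finset (ℕ × BitVec w)} {i d k : ℕ} {s : State w} (h : LPFMemory N T m B i d k s)
    (hN : 0 < N) (x : BitVec w) : LPFMemory N T m B i d k (s.setReg 0 x) where
  regI := by simpa [State.setReg, Function.update_of_ne hN.ne'] using h.regI
  regD := by simpa [State.setReg] using h.regD
  regK := by simpa [State.setReg] using h.regK
  one := by simpa [State.setReg] using h.one
  bound := h.bound
  val := h.val
  used := h.used
  d_le := h.d_le
  k_le := h.k_le
  past := h.past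

theorem RoundInv.exec_round {w σ N : ℕ} {T : List (Fin σ)} {i d k : ℕ} {E : Finset (ℕ × BitVec w)}
    {s t : State w} (h : RoundInv N T i d k E s t) (hw : T.length < 2 ^ w) (hi : i < T.length)
    {P : SuffixTreeAlg} (hP : P.prog.idBound ≤ N) (hleaf : P.leafReg < N) (hlen : P.lenArr < N)
    {x : BitVec w} {s' : State w} {c : ℕ} (he : Exec P.prog (s.setReg 0 x) s' c)
    (hs' : HoldsSuffixTree P s' (T.take (i + 1))) :
    ∃ t' d' k' E' c', Exec (lpfAlg P N).prog (t.setReg 0 x) t' c' ∧ c' ≤ c + 16 ∧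
      RoundInv N T (i + 1) d' k' E' s' t' ∧ d ≤ d' := by
  obtain ⟨t1, e1, a1, u1⟩ := he.simulate hP (t.setReg 0 x) (h.agree.setReg 0 x)
  have m1 := (h.mem.setReg_input (by omega) x).of_untouched (s := s.setReg 0 x) u1
  have hb : t1.arr P.lenArr (t1.reg P.leafReg) = BitVec.ofNat w (finalBound T (i + 1)) := by
    rw [a1.arr _ hlen, a1.reg _ hleaf]
    exact hs'.lenArr_leaf (by omega) hi
  obtain ⟨t2, m2, a2, e2⟩ :=
    m1.exec_read (by omega) hlen hleaf hb (.seq (advance N .skip) (advance N .skip))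
  rw [← Finset.union_insert] at m2
  obtain ⟨t3, c3, d3, k3, e3, hc3, m3, a3, hd3, hk3, hdk3, p3⟩ :=
    m2.exec_advance_skip hw le_rfl hi h.le
  obtain ⟨t4, c4, d4, k4, e4, hc4, m4, a4, hd4, hk4, hdk4, p4⟩ :=
    m3.exec_advance_skip hw le_rfl hi hdk3
  refine ⟨t4, d4, k4, insert (P.lenArr, t1.reg P.leafReg) E, _,
    .seq e1 (e2 t4 _ (.seq e3 e4)), by omega,
    ⟨((a1.trans a2).trans a3).trans a4, m4, ?_, hdk4, ?_⟩, by omega⟩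
  · exact (Finset.card_insert_le _ _).trans (Nat.succ_le_succ h.card_le)
  -- If both steps progress, `d + k` gains 2. Otherwise `k = i + 1` and `d ≥ i + 1 - LRS T (i + 1)`,
  -- and `maxLRS` covers the difference.
  · have hp := h.pace
    have hmono := maxLRS_mono T (Nat.le_succ i)
    have hle := LRS_le_maxLRS T (Nat.succ_pos i)
    have hk4i := m4.k_le
    simp only [finalBound] at p3 p4
    simp only [Nat.succ_eq_add_one] at hmono hle
    omega

theorem RoundInv.exec_finish {w σ N : ℕ} {T : List (Fin σ)} {i d k : ℕ}
    {E : Finset (ℕ × BitVec w)} {s t : State w} (h : RoundInv N T i d k E s t)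
    (hw : T.length < 2 ^ w) (hi : i ≤ T.length) (P : SuffixTreeAlg) :
    ∃ t' c, Exec (lpfAlg P N).finish t t' c ∧ c ≤ 14 * (i - d) + 1 ∧
      (∀ j < i, t'.arr (N + 1) (BitVec.ofNat w j) = BitVec.ofNat w (LPF (T.take i) j)) ∧
      t'.used ⊆ s.used ∪ E ∪ ownCells w N i := by
  -- The horizon shrinks to `i`: values written after the end are correct for `T.take i` only.
  have m : LPFMemory N T i (s.used ∪ E) i d k t :=
    { h.mem with val := fun m' h1 h2 => h.mem.val m' h1 (h2.trans hi) }
  obtain ⟨t', c, k', e, hc, m'⟩ := m.exec_finish hw hi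
  have := h.le
  exact ⟨t', c, e, by omega, m'.val i le_rfl le_rfl, m'.used⟩

/-! ### The whole run and its bounds -/

theorem LPF_le {α : Type*} (T : List α) (j : ℕ) : LPF T j ≤ T.length := by
  refine csSup_le' ?_
  rintro l ⟨u, rfl, hu, -⟩
  have := hu.length_le
  rw [List.length_drop] at this
  omega

/-- A sequence obtained by extending step by step, as long as an invariant holds. -/
theorem exists_chain {α : Type*} (I : ℕ → α → Prop) (R : ℕ → α → α → Prop) (n : ℕ) (a : α)
    (h0 : I 0 a) (h : ∀ i < n, ∀ s, I i s → ∃ s', I (i + 1) s' ∧ R i s s') :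
    ∃ st : ℕ → α, st 0 = a ∧ (∀ i ≤ n, I i (st i)) ∧ ∀ i < n, R i (st i) (st (i + 1)) := by
  classical
  choose! f hf using h
  have key : ∀ i ≤ n, I i (Nat.rec a (fun i s => f i s) i) := by
    intro i
    induction i with
    | zero => exact fun _ => h0
    | succ i ih => exact fun hi => (hf i hi _ (ih (by omega))).1
  exact ⟨Nat.rec a (fun i s => f i s), rfl, key, fun i hi => (hf i hi _ (key i hi.le)).2⟩

theorem Exec.one_le {w : ℕ} {p : Cmd} {s s' : State w} {c : ℕ} (h : Exec p s s' c) : 1 ≤ c := by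
  induction h <;> omega

theorem computesLPFOnline_lpfAlg {P : SuffixTreeAlg} {N : ℕ} (hP : P.prog.idBound ≤ N)
    (hleaf : P.leafReg < N) (hlen : P.lenArr < N) (hN : 3 ≤ N) {w n σ t : ℕ} {space : ℕ → ℕ}
    (hw : n < 2 ^ w) (h : SolvesSuffixUpdate P w n σ t space) :
    ComputesLPFOnline (lpfAlg P N) w n σ (17 * t) 17 (fun i => 17 * (space i + i + 1)) := by
  rintro T rfl
  obtain ⟨sp, ⟨hsp0, hrun⟩, htree⟩ := h T rfl
  obtain ⟨st, hst0, hst, hstep⟩ := exists_chain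
    (fun i u => ∃ d k E, RoundInv N T i d k E (sp i) u)
    (fun i u u' => (∃ c ≤ 17 * t, ∀ hi : i < T.length,
      Exec (lpfAlg P N).prog (u.setReg 0 (BitVec.ofNat w (T[i]).val)) u' c) ∧
        (lpfAlg P N).done u ≤ (lpfAlg P N).done u')
    T.length (State.start w σ) ⟨0, 0, ∅, by rw [hsp0]; exact .start hN T⟩ (by
      rintro i hi u ⟨d, k, E, hu⟩
      obtain ⟨c, hc, he⟩ := hrun i hi
      obtain ⟨u', d', k', E', c', e, hc', hu', hdd⟩ :=
        hu.exec_round hw hi hP hleaf hlen he (htree (i + 1) (by omega) hi).1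
      -- Since `1 ≤ c ≤ t`, the additive overhead 16 of a round is absorbed: `c + 16 ≤ 17 * t`.
      have := he.one_le
      refine ⟨u', ⟨d', k', E', hu'⟩, ⟨c', by omega, fun _ => e⟩, ?_⟩
      have hd := hu.mem.d_le
      have hd' := hu'.mem.d_le
      simp only [LPFAlg.done, lpfAlg]
      rw [hu.mem.regD, hu'.mem.regD, BitVec.toNat_ofNat_of_lt' (by omega),
        BitVec.toNat_ofNat_of_lt' (by omega)]
      exact hdd)
  refine ⟨st, ⟨hst0, fun i hi => ?_⟩, fun i hi => (hstep i hi).2, fun i hi => ?_⟩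
  · obtain ⟨c, hc, he⟩ := (hstep i hi).1
    exact ⟨c, hc, he hi⟩
  · obtain ⟨d, k, E, hu⟩ := hst i hi
    have hd := hu.mem.d_le
    have hk := hu.mem.k_le
    have hdone : (lpfAlg P N).done (st i) = d := by
      simp only [LPFAlg.done, lpfAlg]
      rw [hu.mem.regD, BitVec.toNat_ofNat_of_lt' (by omega)]
    -- The space bound of `P` is assumed only from the first letter on; before it no cell is used.
    have hspace : (sp i).used.card ≤ space i := by
      rcases Nat.eq_zero_or_pos i with rfl | hpos
      · simp [hsp0, State.start]
      · exact (htree i hpos hi).2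
    -- The cells of `P`, at most one leaf edge per round, and `2 * (i + 1)` own cells.
    have hcard : ((sp i).used ∪ E ∪ ownCells w N i).card ≤ 17 * (space i + i + 1) := by
      have h1 := Finset.card_union_le ((sp i).used ∪ E) (ownCells w N i)
      have h2 := Finset.card_union_le (sp i).used E
      have h3 := hu.card_le
      have h4 := card_ownCells_le w N i
      omega
    rw [hdone]
    obtain ⟨s', c, e, hc, hval, hused⟩ := hu.exec_finish hw hi P
    refine ⟨hd, ?_, fun j hj => ?_, (Finset.card_le_card hu.mem.used).trans hcard, s', c, e,
      by omega, fun j hj => ?_, (Finset.card_le_card hused).trans hcard⟩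
    · have := hu.pace
      omega
    · have hl := LPF_le T j
      have := hu.mem.val T.length hi le_rfl j hj
      rw [List.take_length] at this
      change ((st i).arr (N + 1) _).toNat = _
      rw [this, BitVec.toNat_ofNat_of_lt' (by omega)]
    · have hl := LPF_le (T.take i) j
      rw [List.length_take] at hl
      change (s'.arr (N + 1) _).toNat = _
      rw [hval j hj, BitVec.toNat_ofNat_of_lt' (by omega)]

/-- For every online suffix tree algorithm `P` there is an online LPF algorithm `Q` such that, whenever
`P` solves SuffixUpdate for texts of length `n` over `σ` letters on a `w`-bit word RAM in worst-case
time `t` per letter, `Q` computes the LPF array online for these texts in time `O(t)` per letter and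
with at most `max_i LRS[i]` delayed ending values at each round, where the constant `C` is absolute. -/
theorem mainTheorem4 :
    ∃ C : ℕ, ∀ P : SuffixTreeAlg, ∃ Q : LPFAlg,
      ∀ (w n σ t : ℕ) (space : ℕ → ℕ), n < 2 ^ w → σ ≤ 2 ^ w →
        SolvesSuffixUpdate P w n σ t space →
        ComputesLPFOnline Q w n σ (C * t) C (fun i => C * (space i + i + 1)) := by
  -- This `N` lies above all registers and arrays used by `P`; the summand 3 keeps the new registers
  -- clear of registers 0, 1, 2, which carry the input.
  refine ⟨17, fun P => ⟨lpfAlg P (P.prog.idBound + P.leafReg + P.lenArr + 3), ?_⟩⟩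
  intro w n σ t space hn _ h
  exact computesLPFOnline_lpfAlg (by omega) (by omega) (by omega) (by omega) hn h
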